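/- Let $(X,\Sigma,\mu)$ be a $\sigma$-finite measure space satisfying condition $(\star)$: whenever $X=\bigcup_{n\in\mathbb N}X_n$ for an increasing sequence of sets $X_n\in\Sigma$ with $\mu(X_n)<\infty$, every $A\in\Sigma$ with $\mu(A)<\infty$ is contained in some $X_n$ (all relations between sets and between functions are understood up to $\mu$-null sets). Let $\mathcal A\subseteq\Sigma$ be a sub-$\sigma$-algebra such that $\mu|_{\mathcal A}$ is $\sigma$-finite, and let $E=E^{\mathcal A}$ be the conditional expectation with respect to $\mathcal A$, defined for all nonnegative $\Sigma$-measurable functions and for all conditionable functions, i.e. all $\Sigma$-measurable $f:X\to\mathbb C$ with $E(|f|)<\infty$ a.e. Let $u,w:X\to\mathbb C$ be conditionable, and let $T=M_wEM_u$ be the weighted conditional type operator on $L^2(\mu)$, that is, $Tf=wE(uf)$ with domain $\mathcal D(T)=\{f\in L^2(\mu): uf \text{ is conditionable and } wE(uf)\in L^2(\mu)\}$. Assume that $T$ is densely defined. Let $T^\dagger$ be the Moore-Penrose inverse of $T$, i.e. the unique closed densely defined operator on $L^2(\mu)$ with domain $\mathcal D(T^\dagger)=\mathcal R(T)\oplus\mathcal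 R(T)^\perp$ such that $TT^\dagger y=P_{\overline{\mathcal R(T)}}\,y$ for $y\in\mathcal D(T^\dagger)$, $T^\dagger Tx=P_{\mathcal N(T)^\perp}x$ for $x\in\mathcal D(T)$, and $\mathcal N(T^\dagger)=\mathcal R(T)^\perp$. Put $S=\{E(|u|^2)\neq 0\}\cap\{E(|w|^2)\neq 0\}$. Then $T^\dagger$ is bounded if and only if there is $r>0$ such that $E(|u|^2)E(|w|^2)\ge r$ a.e. on $S$. In that case $$\|T^\dagger\|=\left\|\frac{\chi_S}{E(|u|^2)^{1/2}\,E(|w|^2)^{1/2}}\right\|_\infty ,$$ where the function is understood to be $0$ off $S$. -/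

import Mathlib

open MeasureTheory Filter Set
open scoped ENNReal NNReal

noncomputable section

namespace LinearPMap

variable {𝕜 H₁ H₂ : Type*} [RCLike 𝕜]
  [NormedAddCommGroup H₁] [InnerProductSpace 𝕜 H₁]
  [NormedAddCommGroup H₂] [InnerProductSpace 𝕜 H₂]

/-- The range `R(T)` of a partially defined operator. -/
def rangeSub (T : H₁ →ₗ.[𝕜] H₂) : Submodule 𝕜 H₂ := LinearMap.range T.toFun

/-- The null space `N(T) = {x ∈ D(T) : T x = 0}`, as a subspace of the ambient space. -/
def nullSub (T : H₁ →ₗ.[𝕜] H₂) : Submodule 𝕜 H₁ :=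
  (LinearMap.ker T.toFun).map T.domain.subtype

/-- A partially defined operator is bounded if `‖T x‖ ≤ C ‖x‖` on its domain. -/
def IsBoundedOp (T : H₁ →ₗ.[𝕜] H₂) : Prop :=
  ∃ C : ℝ, ∀ x : T.domain, ‖T x‖ ≤ C * ‖(x : H₁)‖

/-- The operator norm `sup {‖T x‖ : x ∈ D(T), ‖x‖ ≤ 1}`, with values in `[0, ∞]`. -/
def opNorm (T : H₁ →ₗ.[𝕜] H₂) : ℝ≥0∞ :=
  ⨆ (x : T.domain) (_ : ‖(x : H₁)‖ ≤ 1), ‖T x‖ₑ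

/-- The defining properties of the Moore-Penrose inverse `S` of a closed densely defined
operator `T`. -/
structure IsMoorePenroseInverse [CompleteSpace H₁] [CompleteSpace H₂]
    (T : H₁ →ₗ.[𝕜] H₂) (S : H₂ →ₗ.[𝕜] H₁) : Prop where
  isClosed : S.IsClosed
  dense_domain : Dense (S.domain : Set H₂)
  domain_eq : S.domain = T.rangeSub ⊔ T.rangeSubᗮ
  apply_inverse : ∀ y : S.domain, ∃ h : S y ∈ T.domain,
    T ⟨S y, h⟩ = T.rangeSub.topologicalClosure.starProjection (y : H₂)
  inverse_apply : ∀ x : T.domain, ∃ h : T x ∈ S.domain,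
    S ⟨T x, h⟩ = T.nullSubᗮ.starProjection (x : H₁)
  nullSub_eq : S.nullSub = T.rangeSubᗮ

/-- The graph of the Moore-Penrose inverse: the pairs `(y, x)` with `x ∈ D(T) ∩ N(T)ᗮ` and
`T x = P y`, where `P` is the orthogonal projection onto the closure of `R(T)`. -/
def moorePenroseGraph [CompleteSpace H₂] (T : H₁ →ₗ.[𝕜] H₂) : Submodule 𝕜 (H₂ × H₁) :=
  T.nullSubᗮ.comap (LinearMap.snd 𝕜 H₂ H₁) ⊓
    T.graph.comap ((LinearMap.snd 𝕜 H₂ H₁).prod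
      ((T.rangeSub.topologicalClosure.starProjection : H₂ →ₗ[𝕜] H₂) ∘ₗ LinearMap.fst 𝕜 H₂ H₁))

/-- The Moore-Penrose inverse `T†`. For a closed operator it is the unique operator with the
properties `IsMoorePenroseInverse`, see `isMoorePenroseInverse_iff`. -/
def moorePenrose [CompleteSpace H₂] (T : H₁ →ₗ.[𝕜] H₂) : H₂ →ₗ.[𝕜] H₁ :=
  T.moorePenroseGraph.toLinearPMap

theorem mem_moorePenroseGraph [CompleteSpace H₂] (T : H₁ →ₗ.[𝕜] H₂) (y : H₂) (x : H₁) :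
    (y, x) ∈ T.moorePenroseGraph ↔
      x ∈ T.nullSubᗮ ∧ (x, T.rangeSub.topologicalClosure.starProjection y) ∈ T.graph := Iff.rfl

theorem mem_nullSub (T : H₁ →ₗ.[𝕜] H₂) (x : H₁) : x ∈ T.nullSub ↔ (x, (0 : H₂)) ∈ T.graph := by
  simp only [nullSub, Submodule.mem_map, LinearMap.mem_ker, mem_graph_iff]
  constructor
  · rintro ⟨y, hy, rfl⟩; exact ⟨y, rfl, hy⟩
  · rintro ⟨y, hy, h⟩; exact ⟨y, h, hy⟩

theorem graph_moorePenrose [CompleteSpace H₂] (T : H₁ →ₗ.[𝕜] H₂) :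
    T.moorePenrose.graph = T.moorePenroseGraph := by
  apply Submodule.toLinearPMap_graph_eq
  rintro ⟨y, x⟩ h (rfl : y = 0)
  rw [mem_moorePenroseGraph, (T.rangeSub.topologicalClosure.starProjection).map_zero,
    ← mem_nullSub] at h
  exact (Submodule.disjoint_def.1 (Submodule.orthogonal_disjoint T.nullSub)) x h.2 h.1

/-- For a closed operator, `moorePenrose` is the one and only Moore-Penrose inverse. -/
theorem isMoorePenroseInverse_iff [CompleteSpace H₁] [CompleteSpace H₂]
    (T : H₁ →ₗ.[𝕜] H₂) (hT : T.IsClosed) (S : H₂ →ₗ.[𝕜] H₁) :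
    T.IsMoorePenroseInverse S ↔ S = T.moorePenrose := by
  set R := T.rangeSub with hR
  set P := R.topologicalClosure.starProjection with hP
  have hPR : ∀ y ∈ R, P y = y := fun y hy =>
    Submodule.starProjection_eq_self_iff.2 (R.le_topologicalClosure hy)
  have hPR' : ∀ y ∈ Rᗮ, P y = 0 := fun y hy => by
    rw [hP, Submodule.starProjection_apply_eq_zero_iff, Submodule.orthogonal_closure]
    exact hy
  have hTR : ∀ x y, (x, y) ∈ T.graph → y ∈ R := by
    intro x y h
    obtain ⟨z, -, hz⟩ := (mem_graph_iff T).1 h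
    exact ⟨z, hz⟩
  have hNclosed : _root_.IsClosed (T.nullSub : Set H₁) := by
    have : (T.nullSub : Set H₁) = (fun x => (x, (0 : H₂))) ⁻¹' (T.graph : Set (H₁ × H₂)) := by
      ext x; exact T.mem_nullSub x
    rw [this]
    exact _root_.IsClosed.preimage (by fun_prop) hT
  have : CompleteSpace T.nullSub := hNclosed.completeSpace_coe
  -- the component of `x` in `N(T)ᗮ` has the same image under `T`
  have hQ : ∀ x y, (x, y) ∈ T.graph → (T.nullSubᗮ.starProjection x, y) ∈ T.graph := by
    intro x y h
    have h1 : T.nullSub.starProjection x ∈ T.nullSub := Submodule.starProjection_apply_mem _ _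
    rw [mem_nullSub] at h1
    have h2 := T.graph.sub_mem h h1
    rw [Submodule.starProjection_orthogonal_val]
    simpa using h2
  have hdecomp : ∀ y ∈ R ⊔ Rᗮ, P y ∈ R := by
    intro y hy
    obtain ⟨a, ha, b, hb, rfl⟩ := Submodule.mem_sup.1 hy
    rw [P.map_add, hPR a ha, hPR' b hb, add_zero]
    exact ha
  have hmem : ∀ y x, (y, x) ∈ T.moorePenrose.graph ↔ x ∈ T.nullSubᗮ ∧ (x, P y) ∈ T.graph := by
    intro y x; rw [graph_moorePenrose]; rfl
  have hdom : T.moorePenrose.domain = R ⊔ Rᗮ := by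
    ext y
    rw [mem_domain_iff]
    constructor
    · rintro ⟨x, hx⟩
      have h2 := hTR _ _ ((hmem _ _).1 hx).2
      have h3 : y - P y ∈ Rᗮ := by
        have := Submodule.sub_starProjection_mem_orthogonal (K := R.topologicalClosure) y
        rwa [Submodule.orthogonal_closure] at this
      have := Submodule.add_mem_sup h2 h3
      simpa using this
    · intro hy
      obtain ⟨z, hz⟩ := hdecomp y hy
      have hz' : ((z : H₁), P y) ∈ T.graph := by
        rw [← hz]; exact T.mem_graph z
      exact ⟨_, (hmem _ _).2 ⟨Submodule.starProjection_apply_mem _ _, hQ _ _ hz'⟩⟩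
  constructor
  · intro h
    apply eq_of_eq_graph
    apply le_antisymm
    · rintro ⟨y, x⟩ hyx
      obtain ⟨y', h1, h2⟩ := (mem_graph_iff S).1 hyx
      simp only at h1 h2
      have hy : y ∈ R ⊔ Rᗮ := by rw [← h1, ← h.domain_eq]; exact y'.2
      obtain ⟨a, ha, b, hb, rfl⟩ := Submodule.mem_sup.1 hy
      obtain ⟨z, hz⟩ := ha
      obtain ⟨hz1, hz2⟩ := h.inverse_apply z
      have hb' : b ∈ S.nullSub := by rw [h.nullSub_eq]; exact hb
      rw [mem_nullSub] at hb'
      have hza : T z = a := hz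
      have h3 : (a, T.nullSubᗮ.starProjection (z : H₁)) ∈ S.graph := by
        rw [← hz2]
        have := S.mem_graph ⟨T z, hz1⟩
        simpa [hza] using this
      have h4 := S.graph.add_mem h3 hb'
      simp only [Prod.mk_add_mk, add_zero] at h4
      have h5 := S.mem_graph_snd_inj hyx h4 rfl
      rw [hmem, h5]
      refine ⟨Submodule.starProjection_apply_mem _ _, hQ _ _ ?_⟩
      rw [P.map_add, hPR a ⟨z, hz⟩, hPR' b hb, add_zero, ← hza]
      exact T.mem_graph z
    · rintro ⟨y, x⟩ hyx
      have hy : y ∈ S.domain := by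
        rw [h.domain_eq, ← hdom]; exact mem_domain_of_mem_graph hyx
      obtain ⟨a, ha, b, hb, hab⟩ := Submodule.mem_sup.1 (h.domain_eq ▸ hy)
      obtain ⟨z, hz⟩ := ha
      obtain ⟨hz1, hz2⟩ := h.inverse_apply z
      have hb' : b ∈ S.nullSub := by rw [h.nullSub_eq]; exact hb
      rw [mem_nullSub] at hb'
      have hza : T z = a := hz
      have h3 : (a, T.nullSubᗮ.starProjection (z : H₁)) ∈ S.graph := by
        rw [← hz2]
        have := S.mem_graph ⟨T z, hz1⟩
        simpa [hza] using this
      have h4 := S.graph.add_mem h3 hb'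
      simp only [Prod.mk_add_mk, add_zero, hab] at h4
      have h6 : (y, T.nullSubᗮ.starProjection (z : H₁)) ∈ T.moorePenrose.graph := by
        rw [hmem]
        refine ⟨Submodule.starProjection_apply_mem _ _, hQ _ _ ?_⟩
        rw [← hab, P.map_add, hPR a ⟨z, hz⟩, hPR' b hb, add_zero, ← hza]
        exact T.mem_graph z
      rw [T.moorePenrose.mem_graph_snd_inj hyx h6 rfl]
      exact h4
  · rintro rfl
    refine ⟨?_, ?_, hdom, ?_, ?_, ?_⟩
    · have : (T.moorePenrose.graph : Set (H₂ × H₁)) =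
          (Prod.snd ⁻¹' (T.nullSubᗮ : Set H₁)) ∩
            (fun p : H₂ × H₁ => (p.2, P p.1)) ⁻¹' (T.graph : Set (H₁ × H₂)) := by
        ext ⟨y, x⟩; exact hmem y x
      change _root_.IsClosed (T.moorePenrose.graph : Set (H₂ × H₁))
      rw [this]
      exact ((Submodule.isClosed_orthogonal _).preimage continuous_snd).inter
        (_root_.IsClosed.preimage (by fun_prop) hT)
    · rw [hdom, Submodule.dense_iff_topologicalClosure_eq_top,
        ← Submodule.orthogonal_orthogonal_eq_closure, Submodule.orthogonal_eq_top_iff,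
        ← Submodule.inf_orthogonal, Submodule.inf_orthogonal_eq_bot]
    · intro y
      have h := ((hmem _ _).1 (T.moorePenrose.mem_graph y)).2
      exact ⟨mem_domain_of_mem_graph h, ((T.image_iff (mem_domain_of_mem_graph h)).2 h).symm⟩
    · intro x
      have h : (T x, T.nullSubᗮ.starProjection (x : H₁)) ∈ T.moorePenrose.graph := by
        rw [hmem, hPR (T x) ⟨x, rfl⟩]
        exact ⟨Submodule.starProjection_apply_mem _ _, hQ _ _ (T.mem_graph x)⟩
      exact ⟨mem_domain_of_mem_graph h,
        ((T.moorePenrose.image_iff (mem_domain_of_mem_graph h)).2 h).symm⟩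
    · ext y
      rw [mem_nullSub, hmem]
      constructor
      · rintro ⟨-, h⟩
        obtain ⟨z, hz1, hz2⟩ := (mem_graph_iff T).1 h
        have hz0 : z = 0 := Subtype.ext (by simpa using hz1)
        have h0 : P y = 0 := by
          have h7 : T z = P y := hz2
          rw [← h7, hz0, map_zero]
        rw [hP, Submodule.starProjection_apply_eq_zero_iff, Submodule.orthogonal_closure] at h0
        exact h0
      · intro h
        rw [hPR' y h]
        exact ⟨Submodule.zero_mem _, T.graph.zero_mem⟩

end LinearPMap

namespace WCT

variable {X : Type*} (m : MeasurableSpace X) {m₀ : MeasurableSpace X}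

/-- The conditional expectation of a real function, `E(p⁺) - E(p⁻)`, where `condLExp` is the
conditional expectation of nonnegative functions. -/
def condExpReal (μ : Measure[m₀] X) (p : X → ℝ) (x : X) : ℝ :=
  (condLExp m μ (fun t => ENNReal.ofReal (p t)) x).toReal -
    (condLExp m μ (fun t => ENNReal.ofReal (-p t)) x).toReal

/-- The conditional expectation `E(f) = E(Re f) + i E(Im f)` of a complex function. It is
meaningful for all conditionable functions, which need not be integrable. -/
def condExpComplex (μ : Measure[m₀] X) (f : X → ℂ) (x : X) : ℂ :=
  (condExpReal m μ (fun t => (f t).re) x : ℂ) +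
    (condExpReal m μ (fun t => (f t).im) x : ℂ) * Complex.I

/-- A function `f` is conditionable if `E(|f|)` is finite almost everywhere. -/
def Conditionable (μ : Measure[m₀] X) (f : X → ℂ) : Prop :=
  ∀ᵐ x ∂μ, condLExp m μ (fun t => ‖f t‖ₑ) x < ∞

/-- `E(|f|²)`, with values in `[0, ∞]`. -/
def condSq (μ : Measure[m₀] X) (f : X → ℂ) : X → ℝ≥0∞ :=
  condLExp m μ (fun t => ‖f t‖ₑ ^ 2)

/-- The set `S = {E(|u|²) ≠ 0} ∩ {E(|w|²) ≠ 0}`. -/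
def suppSet (μ : Measure[m₀] X) (u w : X → ℂ) : Set X :=
  {x | condSq m μ u x ≠ 0 ∧ condSq m μ w x ≠ 0}

/-- The condition `(⋆)`: whenever the space is the union of an increasing sequence of measurable
sets of finite measure, every measurable set of finite measure is contained in one of them (unions
and inclusions of sets are understood up to null sets). -/
def StarCondition (μ : Measure[m₀] X) : Prop :=
  ∀ Y : ℕ → Set X, Monotone Y → (∀ n, MeasurableSet (Y n)) → (∀ n, μ (Y n) < ∞) →
    (⋃ n, Y n) =ᵐ[μ] univ → ∀ A : Set X, MeasurableSet A → μ A < ∞ → ∃ n, A ≤ᵐ[μ] Y n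

section Lemmas

variable {m} {μ : Measure[m₀] X}

theorem condExpReal_eq_sub {p : X → ℝ} {a b : X → ℝ≥0∞} (hp : AEMeasurable p μ)
    (h : ∀ᵐ x ∂μ, ENNReal.ofReal (p x) + b x = ENNReal.ofReal (-p x) + a x)
    (hp1 : ∀ᵐ x ∂μ, condLExp m μ (fun t => ENNReal.ofReal (p t)) x < ∞)
    (hp2 : ∀ᵐ x ∂μ, condLExp m μ (fun t => ENNReal.ofReal (-p t)) x < ∞)
    (ha' : ∀ᵐ x ∂μ, condLExp m μ a x < ∞) (hb' : ∀ᵐ x ∂μ, condLExp m μ b x < ∞) :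
    condExpReal m μ p =ᵐ[μ] fun x => (condLExp m μ a x).toReal - (condLExp m μ b x).toReal := by
  have e1 := condLExp_add_left (mΩ := m) b (hp.ennreal_ofReal)
  have e2 := condLExp_add_left (mΩ := m) a (hp.neg.ennreal_ofReal)
  have e3 : condLExp m μ ((fun x => ENNReal.ofReal (p x)) + b) =ᵐ[μ]
      condLExp m μ ((fun x => ENNReal.ofReal (-p x)) + a) := condLExp_congr_ae h
  filter_upwards [e1, e2, e3, hp1, hp2, ha', hb'] with x h1 h2 h3 h4 h5 h6 h7
  have h2' : condLExp m μ ((fun x => ENNReal.ofReal (-p x)) + a) x =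
    condLExp m μ (fun x => ENNReal.ofReal (-p x)) x + condLExp m μ a x := h2
  rw [h1, h2', Pi.add_apply] at h3
  have h8 := congrArg ENNReal.toReal h3
  rw [ENNReal.toReal_add h4.ne h7.ne, ENNReal.toReal_add h5.ne h6.ne] at h8
  simp only [condExpReal]
  linarith

theorem condLExp_lt_top_of_le {a b : X → ℝ≥0∞} (hab : ∀ x, a x ≤ b x)
    (hb : ∀ᵐ x ∂μ, condLExp m μ b x < ∞) : ∀ᵐ x ∂μ, condLExp m μ a x < ∞ := by
  filter_upwards [condLExp_mono (mΩ := m) (P := μ) (ae_of_all _ hab), hb] with x h1 h2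
  exact h1.trans_lt h2

theorem condExpReal_add {p q : X → ℝ} (hp : AEMeasurable p μ) (hq : AEMeasurable q μ)
    (hp' : ∀ᵐ x ∂μ, condLExp m μ (fun t => ‖p t‖ₑ) x < ∞)
    (hq' : ∀ᵐ x ∂μ, condLExp m μ (fun t => ‖q t‖ₑ) x < ∞) :
    condExpReal m μ (fun t => p t + q t) =ᵐ[μ]
      fun x => condExpReal m μ p x + condExpReal m μ q x := by
  have bd : ∀ r : ℝ, ENNReal.ofReal r ≤ ‖r‖ₑ := fun r => Real.ofReal_le_enorm r
  have bd' : ∀ r : ℝ, ENNReal.ofReal (-r) ≤ ‖r‖ₑ := fun r => by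
    simpa using Real.ofReal_le_enorm (-r)
  have hp1 := condLExp_lt_top_of_le (fun x => bd (p x)) hp'
  have hp2 := condLExp_lt_top_of_le (fun x => bd' (p x)) hp'
  have hq1 := condLExp_lt_top_of_le (fun x => bd (q x)) hq'
  have hq2 := condLExp_lt_top_of_le (fun x => bd' (q x)) hq'
  have e1 := condLExp_add_left (mΩ := m) (fun x => ENNReal.ofReal (q x)) hp.ennreal_ofReal
  have e2 := condLExp_add_left (mΩ := m) (fun x => ENNReal.ofReal (-q x)) hp.neg.ennreal_ofReal
  have f1 : ∀ᵐ x ∂μ, condLExp m μ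
      ((fun x => ENNReal.ofReal (p x)) + fun x => ENNReal.ofReal (q x)) x < ∞ := by
    filter_upwards [e1, hp1, hq1] with x h1 h2 h3
    rw [h1]; exact ENNReal.add_lt_top.2 ⟨h2, h3⟩
  have f2 : ∀ᵐ x ∂μ, condLExp m μ
      ((fun x => ENNReal.ofReal (-p x)) + fun x => ENNReal.ofReal (-q x)) x < ∞ := by
    filter_upwards [e2, hp2, hq2] with x h1 h2 h3
    have h1' : _ = condLExp m μ (fun x => ENNReal.ofReal (-p x)) x +
      condLExp m μ (fun x => ENNReal.ofReal (-q x)) x := h1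
    have h4 := h1'.trans_lt (ENNReal.add_lt_top.2 ⟨h2, h3⟩)
    exact h4
  have key := condExpReal_eq_sub (m := m) (hp.add hq)
    (a := (fun x => ENNReal.ofReal (p x)) + fun x => ENNReal.ofReal (q x))
    (b := (fun x => ENNReal.ofReal (-p x)) + fun x => ENNReal.ofReal (-q x))
    (ae_of_all _ fun x => by
      simp only [Pi.add_apply]
      rw [← ENNReal.toReal_eq_toReal_iff' (by finiteness) (by finiteness)]
      repeat rw [ENNReal.toReal_add (by finiteness) (by finiteness)]
      simp only [ENNReal.toReal_ofReal']
      have z : ∀ r : ℝ, max r 0 - max (-r) 0 = r := fun r => max_zero_sub_eq_self r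
      linarith [z (p x), z (q x), z (p x + q x)])
    (condLExp_lt_top_of_le (fun x => (ENNReal.ofReal_add_le : _ ≤ _)) f1)
    (condLExp_lt_top_of_le (fun x => by
      simp only [Pi.add_apply, neg_add]; exact ENNReal.ofReal_add_le) f2) f1 f2
  filter_upwards [key, e1, e2, hp1, hp2, hq1, hq2] with x h0 h1 h2 h3 h4 h5 h6
  have h2' : condLExp m μ ((fun x => ENNReal.ofReal (-p x)) + fun x => ENNReal.ofReal (-q x)) x =
    condLExp m μ (fun x => ENNReal.ofReal (-p x)) x +
      condLExp m μ (fun x => ENNReal.ofReal (-q x)) x := h2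
  refine (h0 : condExpReal m μ (fun t => p t + q t) x = _).trans ?_
  rw [h1, h2', Pi.add_apply, ENNReal.toReal_add h3.ne h5.ne, ENNReal.toReal_add h4.ne h6.ne]
  simp only [condExpReal]
  ring

theorem condExpReal_neg (p : X → ℝ) :
    condExpReal m μ (fun t => -p t) = fun x => -condExpReal m μ p x := by
  ext x; simp [condExpReal]

theorem condExpReal_const_mul (c : ℝ) (p : X → ℝ) :
    condExpReal m μ (fun t => c * p t) =ᵐ[μ] fun x => c * condExpReal m μ p x := by
  have pos : ∀ c : ℝ, 0 ≤ c →
      condExpReal m μ (fun t => c * p t) =ᵐ[μ] fun x => c * condExpReal m μ p x := by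
    intro c hc
    have e1 := condLExp_smul' (P := μ) (mΩ := m) (fun t => ENNReal.ofReal (p t))
      (c := ENNReal.ofReal c) ENNReal.ofReal_ne_top
    have e2 := condLExp_smul' (P := μ) (mΩ := m) (fun t => ENNReal.ofReal (-p t))
      (c := ENNReal.ofReal c) ENNReal.ofReal_ne_top
    have g1 : (fun t => ENNReal.ofReal (c * p t)) =
        ENNReal.ofReal c • fun t => ENNReal.ofReal (p t) := by
      ext t; simp [ENNReal.ofReal_mul hc]
    have g2 : (fun t => ENNReal.ofReal (-(c * p t))) =
        ENNReal.ofReal c • fun t => ENNReal.ofReal (-p t) := by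
      ext t; simp [← ENNReal.ofReal_mul hc]
    filter_upwards [e1, e2] with x h1 h2
    simp only [condExpReal, g1, g2, h1, h2, Pi.smul_apply, smul_eq_mul, ENNReal.toReal_mul,
      ENNReal.toReal_ofReal hc]
    ring
  rcases le_total 0 c with hc | hc
  · exact pos c hc
  · have h1 := pos (-c) (by linarith)
    have h2 : (fun t => c * p t) = fun t => -(-c * p t) := by ext t; ring
    rw [h2, condExpReal_neg]
    filter_upwards [h1] with x hx
    rw [hx]; ring

theorem condExpReal_congr {p q : X → ℝ} (h : p =ᵐ[μ] q) :
    condExpReal m μ p =ᵐ[μ] condExpReal m μ q := by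
  have e1 : condLExp m μ (fun t => ENNReal.ofReal (p t)) =ᵐ[μ]
      condLExp m μ (fun t => ENNReal.ofReal (q t)) :=
    condLExp_congr_ae (by filter_upwards [h] with x hx; rw [hx])
  have e2 : condLExp m μ (fun t => ENNReal.ofReal (-p t)) =ᵐ[μ]
      condLExp m μ (fun t => ENNReal.ofReal (-q t)) :=
    condLExp_congr_ae (by filter_upwards [h] with x hx; rw [hx])
  filter_upwards [e1, e2] with x h1 h2
  simp only [condExpReal, h1, h2]

theorem condExpComplex_congr {f g : X → ℂ} (h : f =ᵐ[μ] g) :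
    condExpComplex m μ f =ᵐ[μ] condExpComplex m μ g := by
  have e1 := condExpReal_congr (m := m) (μ := μ) (p := fun t => (f t).re) (q := fun t => (g t).re)
    (by filter_upwards [h] with x hx; rw [hx])
  have e2 := condExpReal_congr (m := m) (μ := μ) (p := fun t => (f t).im) (q := fun t => (g t).im)
    (by filter_upwards [h] with x hx; rw [hx])
  filter_upwards [e1, e2] with x h1 h2
  simp only [condExpComplex, h1, h2]

theorem Conditionable.congr {f g : X → ℂ} (hf : Conditionable m μ f) (h : f =ᵐ[μ] g) :
    Conditionable m μ g := by
  have e : condLExp m μ (fun t => ‖f t‖ₑ) =ᵐ[μ] condLExp m μ (fun t => ‖g t‖ₑ) :=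
    condLExp_congr_ae (by filter_upwards [h] with x hx; rw [hx])
  filter_upwards [hf, e] with x h1 h2
  rwa [← h2]

theorem Conditionable.re {f : X → ℂ} (hf : Conditionable m μ f) :
    ∀ᵐ x ∂μ, condLExp m μ (fun t => ‖(f t).re‖ₑ) x < ∞ :=
  condLExp_lt_top_of_le (fun x => by
    rw [enorm_le_iff_norm_le]; exact Complex.abs_re_le_norm _) hf

theorem Conditionable.im {f : X → ℂ} (hf : Conditionable m μ f) :
    ∀ᵐ x ∂μ, condLExp m μ (fun t => ‖(f t).im‖ₑ) x < ∞ :=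
  condLExp_lt_top_of_le (fun x => by
    rw [enorm_le_iff_norm_le]; exact Complex.abs_im_le_norm _) hf

theorem Conditionable.add {f g : X → ℂ} (hfm : AEMeasurable f μ) (hf : Conditionable m μ f)
    (hg : Conditionable m μ g) : Conditionable m μ (fun x => f x + g x) := by
  have e := condLExp_add_left (mΩ := m) (fun t => ‖g t‖ₑ) hfm.enorm
  refine condLExp_lt_top_of_le (b := (fun t => ‖f t‖ₑ) + fun t => ‖g t‖ₑ)
    (fun x => enorm_add_le _ _) ?_
  filter_upwards [e, hf, hg] with x h1 h2 h3
  rw [h1]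
  exact ENNReal.add_lt_top.2 ⟨h2, h3⟩

theorem Conditionable.const_mul {f : X → ℂ} (c : ℂ) (hf : Conditionable m μ f) :
    Conditionable m μ (fun x => c * f x) := by
  have e := condLExp_smul' (P := μ) (mΩ := m) (fun t => ‖f t‖ₑ) (c := ‖c‖ₑ) enorm_ne_top
  have g : (fun t => ‖c * f t‖ₑ) = ‖c‖ₑ • fun t => ‖f t‖ₑ := by ext t; simp
  unfold Conditionable
  rw [g]
  filter_upwards [e, hf] with x h1 h2
  rw [h1]
  exact ENNReal.mul_lt_top enorm_lt_top h2

theorem condExpComplex_add {f g : X → ℂ} (hfm : AEMeasurable f μ) (hgm : AEMeasurable g μ)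
    (hf : Conditionable m μ f) (hg : Conditionable m μ g) :
    condExpComplex m μ (fun x => f x + g x) =ᵐ[μ]
      fun x => condExpComplex m μ f x + condExpComplex m μ g x := by
  have e1 := condExpReal_add (m := m) (Complex.measurable_re.comp_aemeasurable hfm)
    (Complex.measurable_re.comp_aemeasurable hgm) hf.re hg.re
  have e2 := condExpReal_add (m := m) (Complex.measurable_im.comp_aemeasurable hfm)
    (Complex.measurable_im.comp_aemeasurable hgm) hf.im hg.im
  filter_upwards [e1, e2] with x h1 h2
  simp only [Function.comp_def] at h1 h2
  simp only [condExpComplex, Complex.add_re, Complex.add_im, h1, h2]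
  push_cast
  ring

theorem condExpComplex_const_mul {f : X → ℂ} (c : ℂ) (hfm : AEMeasurable f μ)
    (hf : Conditionable m μ f) :
    condExpComplex m μ (fun x => c * f x) =ᵐ[μ] fun x => c * condExpComplex m μ f x := by
  have hre : AEMeasurable (fun x => (f x).re) μ := Complex.measurable_re.comp_aemeasurable hfm
  have him : AEMeasurable (fun x => (f x).im) μ := Complex.measurable_im.comp_aemeasurable hfm
  have fin : ∀ (a : ℝ) {p : X → ℝ}, (∀ᵐ x ∂μ, condLExp m μ (fun t => ‖p t‖ₑ) x < ∞) →
      ∀ᵐ x ∂μ, condLExp m μ (fun t => ‖a * p t‖ₑ) x < ∞ := by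
    intro a p hp
    have e := condLExp_smul' (P := μ) (mΩ := m) (fun t => ‖p t‖ₑ) (c := ‖a‖ₑ) enorm_ne_top
    have g : (fun t => ‖a * p t‖ₑ) = ‖a‖ₑ • fun t => ‖p t‖ₑ := by ext t; simp
    rw [g]
    filter_upwards [e, hp] with x h1 h2
    rw [h1]
    exact ENNReal.mul_lt_top enorm_lt_top h2
  have e1 := condExpReal_add (m := m) (hre.const_mul c.re) (him.const_mul (-c.im))
    (fin _ hf.re) (fin _ hf.im)
  have e2 := condExpReal_add (m := m) (him.const_mul c.re) (hre.const_mul c.im)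
    (fin _ hf.im) (fin _ hf.re)
  have s1 := condExpReal_const_mul (m := m) (μ := μ) c.re (fun x => (f x).re)
  have s2 := condExpReal_const_mul (m := m) (μ := μ) (-c.im) (fun x => (f x).im)
  have s3 := condExpReal_const_mul (m := m) (μ := μ) c.re (fun x => (f x).im)
  have s4 := condExpReal_const_mul (m := m) (μ := μ) c.im (fun x => (f x).re)
  have g1 : (fun t => (c * f t).re) = fun t => c.re * (f t).re + -c.im * (f t).im := by
    ext t; rw [Complex.mul_re]; ring
  have g2 : (fun t => (c * f t).im) = fun t => c.re * (f t).im + c.im * (f t).re := by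
    ext t; rw [Complex.mul_im]
  filter_upwards [e1, e2, s1, s2, s3, s4] with x h1 h2 k1 k2 k3 k4
  simp only [condExpComplex, g1, g2, h1, h2, k1, k2, k3, k4]
  apply Complex.ext
  · simp; ring
  · simp

variable {u : X →ₘ[μ] ℂ}

theorem aemeasurable_mul_Lp (u : X →ₘ[μ] ℂ) (f : Lp ℂ 2 μ) :
    AEMeasurable (fun x => u x * f x) μ :=
  u.aemeasurable.mul (Lp.aestronglyMeasurable f).aemeasurable

theorem mul_add_Lp (u : X →ₘ[μ] ℂ) (f g : Lp ℂ 2 μ) :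
    (fun x => u x * f x + u x * g x) =ᵐ[μ] fun x => u x * (f + g : Lp ℂ 2 μ) x := by
  filter_upwards [Lp.coeFn_add f g] with x hx
  rw [hx, Pi.add_apply, mul_add]

theorem mul_smul_Lp (u : X →ₘ[μ] ℂ) (c : ℂ) (f : Lp ℂ 2 μ) :
    (fun x => c * (u x * f x)) =ᵐ[μ] fun x => u x * (c • f : Lp ℂ 2 μ) x := by
  filter_upwards [Lp.coeFn_smul c f] with x hx
  rw [hx, Pi.smul_apply, smul_eq_mul]; ring

theorem wct_add (w : X →ₘ[μ] ℂ) {f g : Lp ℂ 2 μ}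
    (hf : Conditionable m μ (fun x => u x * f x)) (hg : Conditionable m μ (fun x => u x * g x)) :
    (fun x => w x * condExpComplex m μ (fun t => u t * (f + g : Lp ℂ 2 μ) t) x) =ᵐ[μ]
      (fun x => w x * condExpComplex m μ (fun t => u t * f t) x) +
        fun x => w x * condExpComplex m μ (fun t => u t * g t) x := by
  filter_upwards [condExpComplex_congr (m := m) (mul_add_Lp u f g),
    condExpComplex_add (aemeasurable_mul_Lp u f) (aemeasurable_mul_Lp u g) hf hg] with x h1 h2
  rw [Pi.add_apply, ← h1, h2, mul_add]

theorem wct_smul (w : X →ₘ[μ] ℂ) (c : ℂ) {f : Lp ℂ 2 μ}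
    (hf : Conditionable m μ (fun x => u x * f x)) :
    (fun x => w x * condExpComplex m μ (fun t => u t * (c • f : Lp ℂ 2 μ) t) x) =ᵐ[μ]
      c • fun x => w x * condExpComplex m μ (fun t => u t * f t) x := by
  filter_upwards [condExpComplex_congr (m := m) (mul_smul_Lp u c f),
    condExpComplex_const_mul c (aemeasurable_mul_Lp u f) hf] with x h1 h2
  rw [Pi.smul_apply, ← h1, h2, smul_eq_mul]; ring

end Lemmas

/-- The domain of the weighted conditional type operator `M_w E M_u` on `L²(μ)`: all `f ∈ L²(μ)`
such that `u f` is conditionable and `w E(u f) ∈ L²(μ)`. -/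
def wctDomain (μ : Measure[m₀] X) (u w : X →ₘ[μ] ℂ) : Submodule ℂ (Lp ℂ 2 μ) where
  carrier := {f | Conditionable m μ (fun x => u x * f x) ∧
    MemLp (fun x => w x * condExpComplex m μ (fun t => u t * f t) x) 2 μ}
  add_mem' := by
    rintro f g ⟨hf, hf'⟩ ⟨hg, hg'⟩
    exact ⟨(hf.add (aemeasurable_mul_Lp u f) hg).congr (mul_add_Lp u f g),
      (memLp_congr_ae (wct_add w hf hg)).2 (hf'.add hg')⟩
  zero_mem' := by
    have hc : (fun x => u x * (0 : Lp ℂ 2 μ) x) =ᵐ[μ] fun _ => 0 := by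
      filter_upwards [Lp.coeFn_zero ℂ 2 μ] with x hx
      rw [hx, Pi.zero_apply, mul_zero]
    have hz : (fun _ : X => (0 : ℝ≥0∞)) = 0 := rfl
    have h0 : Conditionable m μ (fun _ : X => (0 : ℂ)) := by
      simp [Conditionable, hz]
    refine ⟨h0.congr hc.symm, (memLp_congr_ae ?_).1 (MemLp.zero (ε := ℂ))⟩
    filter_upwards [condExpComplex_congr (m := m) hc] with x h1
    rw [h1]
    simp [condExpComplex, condExpReal]
  smul_mem' := by
    rintro c f ⟨hf, hf'⟩
    exact ⟨(hf.const_mul c).congr (mul_smul_Lp u c f),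
      (memLp_congr_ae (wct_smul w c hf)).2 (hf'.const_smul c)⟩

/-- The weighted conditional type operator `T = M_w E M_u` on `L²(μ)`, `T f = w E(u f)`. -/
def wctOp (μ : Measure[m₀] X) (u w : X →ₘ[μ] ℂ) : Lp ℂ 2 μ →ₗ.[ℂ] Lp ℂ 2 μ where
  domain := wctDomain m μ u w
  toFun :=
    { toFun := fun f => MemLp.toLp
        (fun x => w x * condExpComplex m μ (fun t => u t * (f : Lp ℂ 2 μ) t) x) f.2.2
      map_add' := fun f g => by
        rw [← MemLp.toLp_add, MemLp.toLp_eq_toLp_iff]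
        exact wct_add w f.2.1 g.2.1
      map_smul' := fun c f => by
        rw [RingHom.id_apply, ← MemLp.toLp_const_smul, MemLp.toLp_eq_toLp_iff]
        exact wct_smul w c f.2.1 }

end WCT

end

/-! Write `a = E(|u|²)` and `b = E(|w|²)`. Everything follows from one equivalence with an explicit
constant: for `C ≥ 0`, `T†` is bounded by `C` iff `1 ≤ C² a b` a.e. on `S`
(`moorePenrose_wctOp_le_iff`). Boundedness is then the existence of such a `C`. The norm formula
holds because `‖T†‖` and the essential supremum of `χ_S / √(ab)` have the same upper bounds.

Abstractly, `T†` inverts `T` on `D(T) ∩ N(T)ᗮ` after a projection, so it is bounded by `C` iff `‖f‖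
≤ C ‖T f‖` on that subspace (`moorePenrose_le_iff`). Condition `(⋆)` makes `a` and `b` finite a.e.
(`condSq_lt_top`). For `𝒜`-measurable `h` the pull-out property gives `E(u · ū h) = a h`, so `‖ū h‖²
= ∫ |h|² a`, while `‖T(ū h)‖² = ∫ |h|² a² b` whenever `ū h` is in the domain. The ratio of the
integrands is `a b`.

Sufficiency (`norm_le_of_mem_orthogonal_nullSub`): any `f` in the domain has the same image as `g =
ū h` with `h = χ_S E(uf) / a`. If `f ⊥ N(T)`, then `f ⊥ f - g`, hence `‖f‖ ≤ ‖g‖`, and the integrals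
above bound `‖g‖` by `C ‖T f‖`.

Necessity (`one_le_of_lower_bound`): the vectors `ū χ_B` with `b ≠ 0` on `B` are orthogonal to
`N(T)`. Testing on them gives `∫_B a ≤ C² ∫_B a² b` for enough sets `B ∈ 𝒜` to conclude `a ≤ C² a²
b` a.e. on `S`. -/

namespace LinearPMap

/-! ### Boundedness of the Moore-Penrose inverse as a lower bound for the operator -/

variable {𝕜 H₁ H₂ : Type*} [RCLike 𝕜]
  [NormedAddCommGroup H₁] [InnerProductSpace 𝕜 H₁]
  [NormedAddCommGroup H₂] [InnerProductSpace 𝕜 H₂]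

/-- The Moore-Penrose inverse is bounded by `C` iff `T` is bounded below by `1 / C` on
`D(T) ∩ N(T)ᗮ`. -/
theorem moorePenrose_le_iff [CompleteSpace H₂] (T : H₁ →ₗ.[𝕜] H₂) {C : ℝ} (hC : 0 ≤ C) :
    (∀ y : T.moorePenrose.domain, ‖T.moorePenrose y‖ ≤ C * ‖(y : H₂)‖) ↔
      ∀ x : T.domain, (x : H₁) ∈ T.nullSubᗮ → ‖(x : H₁)‖ ≤ C * ‖T x‖ := by
  constructor
  · intro h x hx
    -- `P` fixes `T x`, so for `x ⊥ N(T)` the pair `(T x, x)` lies in the graph of `T†`.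
    have hP : T.rangeSub.topologicalClosure.starProjection (T x) = T x :=
      Submodule.starProjection_eq_self_iff.2 (T.rangeSub.le_topologicalClosure ⟨x, rfl⟩)
    have hg : (T x, (x : H₁)) ∈ T.moorePenrose.graph := by
      rw [graph_moorePenrose, mem_moorePenroseGraph, hP]
      exact ⟨hx, T.mem_graph x⟩
    obtain ⟨y, hy1, hy2⟩ := (mem_graph_iff _).1 hg
    simp only at hy1 hy2
    rw [← hy1, ← hy2]
    exact h y
  · intro h y
    have hg := T.moorePenrose.mem_graph y
    rw [graph_moorePenrose, mem_moorePenroseGraph] at hg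
    obtain ⟨x, hx1, hx2⟩ := (mem_graph_iff _).1 hg.2
    simp only at hx1 hx2
    -- With `x = T† y`, the lower bound reads `‖T† y‖ ≤ C ‖P y‖`, and `P` is a contraction.
    have h1 := h x (hx1 ▸ hg.1)
    rw [hx1, hx2] at h1
    exact h1.trans (mul_le_mul_of_nonneg_left
      (Submodule.norm_starProjection_apply_le _ _) hC)

theorem opNorm_le_iff (T : H₁ →ₗ.[𝕜] H₂) (C : ℝ≥0) :
    T.opNorm ≤ C ↔ ∀ x : T.domain, ‖T x‖ ≤ C * ‖(x : H₁)‖ := by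
  simp only [opNorm, iSup_le_iff]
  have e : ∀ x : T.domain, ‖T x‖ₑ ≤ (C : ℝ≥0∞) ↔ ‖T x‖ ≤ C := fun x => by
    rw [enorm_eq_nnnorm, ENNReal.coe_le_coe, ← NNReal.coe_le_coe, coe_nnnorm]
  simp only [e]
  constructor
  · intro h x
    rcases eq_or_ne (x : H₁) 0 with hx | hx
    · have : x = 0 := Subtype.ext hx
      simp [this]
    · have hn : 0 < ‖(x : H₁)‖ := norm_pos_iff.2 hx
      have h1 := h (((‖(x : H₁)‖⁻¹ : ℝ) : 𝕜) • x) (by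
        rw [Submodule.coe_smul, norm_smul]; simp [hn.ne'])
      rw [map_smul, norm_smul, RCLike.norm_ofReal, abs_of_pos (inv_pos.2 hn), inv_mul_le_iff₀ hn]
        at h1
      linarith
  · intro h x hx
    exact (h x).trans (mul_le_of_le_one_right C.2 hx)

theorem isBoundedOp_iff_exists_nnreal (T : H₁ →ₗ.[𝕜] H₂) :
    T.IsBoundedOp ↔ ∃ C : ℝ≥0, ∀ x : T.domain, ‖T x‖ ≤ C * ‖(x : H₁)‖ := by
  refine ⟨fun ⟨C, h⟩ => ⟨C.toNNReal, fun x => (h x).trans ?_⟩, fun ⟨C, h⟩ => ⟨C, h⟩⟩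
  exact mul_le_mul_of_nonneg_right (Real.le_coe_toNNReal C) (norm_nonneg _)

end LinearPMap

namespace WCT

/-! ### Conditional expectation of nonnegative functions -/

section CondLExp

variable {X : Type*} {m m₀ : MeasurableSpace X} {μ : Measure[m₀] X}

/-- The measures with densities `E(k)` and `k` agree on `𝒜`, so they give the same integral to every
`𝒜`-measurable `h`. -/
theorem lintegral_mul_condLExp (hm : m ≤ m₀) [SigmaFinite (μ.trim hm)] {h k : X → ℝ≥0∞}
    (hh : Measurable[m] h) (hk : AEMeasurable k μ) :
    ∫⁻ x, h x * condLExp m μ k x ∂μ = ∫⁻ x, h x * k x ∂μ := by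
  have e : (μ.withDensity (condLExp m μ k)).trim hm = (μ.withDensity k).trim hm := by
    refine @Measure.ext _ m _ _ fun s hs => ?_
    rw [trim_measurableSet_eq hm hs, trim_measurableSet_eq hm hs, withDensity_apply _ (hm s hs),
      withDensity_apply _ (hm s hs), setLIntegral_condLExp hm _ _ hs]
  have hh' : Measurable[m₀] h := hh.mono hm le_rfl
  have e1 := lintegral_trim (μ := μ.withDensity (condLExp m μ k)) hm hh
  have e2 := lintegral_trim (μ := μ.withDensity k) hm hh
  rw [lintegral_withDensity_eq_lintegral_mul₀ (by fun_prop) hh'.aemeasurable] at e1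
  rw [lintegral_withDensity_eq_lintegral_mul₀ hk hh'.aemeasurable] at e2
  rw [e, e2] at e1
  simpa only [Pi.mul_apply, mul_comm] using e1.symm

/-- The pull-out property of the conditional expectation of nonnegative functions. -/
theorem condLExp_mul_left (hm : m ≤ m₀) [SigmaFinite (μ.trim hm)] {h k : X → ℝ≥0∞}
    (hh : Measurable[m] h) (hk : AEMeasurable k μ) :
    condLExp m μ (fun x => h x * k x) =ᵐ[μ] fun x => h x * condLExp m μ k x := by
  refine (ae_eq_condLExp hm μ _ (hh.mul (measurable_condLExp m μ k)) fun s hs => ?_).symm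
  have h1 := lintegral_mul_condLExp hm (hh.indicator hs) hk
  have key : ∀ g : X → ℝ≥0∞, ∫⁻ x in s, h x * g x ∂μ = ∫⁻ x, s.indicator h x * g x ∂μ := by
    intro g
    rw [← lintegral_indicator (hm s hs)]
    exact lintegral_congr fun x => by by_cases hx : x ∈ s <;> simp [hx]
  change ∫⁻ x in s, h x * condLExp m μ k x ∂μ = _
  rw [key, key, h1]

/-- `k` and `E(k)` have equal integrals over the spanning sets, which belong to `𝒜` and exhaust the
space; a function with finite integral is finite a.e. -/
theorem condLExp_lt_top_of_setLIntegral (hm : m ≤ m₀) [SigmaFinite (μ.trim hm)] {k : X → ℝ≥0∞}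
    (h : ∀ n, ∫⁻ x in spanningSets (μ.trim hm) n, k x ∂μ ≠ ∞) :
    ∀ᵐ x ∂μ, condLExp m μ k x < ∞ := by
  have h1 : ∀ n, ∀ᵐ x ∂μ, x ∈ spanningSets (μ.trim hm) n → condLExp m μ k x < ∞ := by
    intro n
    have hs := measurableSet_spanningSets (μ.trim hm) n
    rw [← ae_restrict_iff' (hm _ hs)]
    refine ae_lt_top (measurable_condLExp' m μ k) ?_
    rw [setLIntegral_condLExp hm _ _ hs]
    exact h n
  filter_upwards [ae_all_iff.2 h1] with x hx
  obtain ⟨n, hn⟩ := mem_iUnion.1 ((iUnion_spanningSets (μ.trim hm)).symm ▸ mem_univ x)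
  exact hx n hn

/-- Conditional expectation is local: it vanishes where its argument does. -/
theorem condLExp_eq_zero_on (hm : m ≤ m₀) [SigmaFinite (μ.trim hm)] {k : X → ℝ≥0∞} {s : Set X}
    (hs : MeasurableSet[m] s) (h : ∀ᵐ x ∂μ, x ∈ s → k x = 0) :
    ∀ᵐ x ∂μ, x ∈ s → condLExp m μ k x = 0 := by
  rw [← ae_restrict_iff' (hm s hs)] at h ⊢
  have h1 := setLIntegral_condLExp hm μ k hs
  rw [lintegral_congr_ae h, lintegral_zero, lintegral_eq_zero_iff (measurable_condLExp' m μ k)]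
    at h1
  exact h1

/-- The set `{E(k) = 0}` is in `𝒜`, so `k` has the same integral over it as `E(k)`, namely `0`.
Applied to `|u|²` and `|w|²`, this makes `u` and `w` vanish where `a` and `b` do. -/
theorem ae_eq_zero_of_condLExp_eq_zero (hm : m ≤ m₀) [SigmaFinite (μ.trim hm)] {k : X → ℝ≥0∞}
    (hk : AEMeasurable k μ) : ∀ᵐ x ∂μ, condLExp m μ k x = 0 → k x = 0 := by
  have hs : MeasurableSet[m] {x | condLExp m μ k x = 0} :=
    measurable_condLExp m μ k (measurableSet_singleton 0)
  change ∀ᵐ x ∂μ, x ∈ {x | condLExp m μ k x = 0} → k x = 0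
  rw [← ae_restrict_iff' (hm _ hs)]
  have h1 := setLIntegral_condLExp hm μ k hs
  rw [setLIntegral_congr_fun (hm _ hs) (fun x hx => hx), lintegral_zero, eq_comm,
    lintegral_eq_zero_iff' hk.restrict] at h1
  exact h1

end CondLExp

/-! ### Conditional expectation of real and complex functions -/

section CondExp

variable {X : Type*} {m m₀ : MeasurableSpace X} {μ : Measure[m₀] X}

theorem measurable_condExpReal (p : X → ℝ) : Measurable[m] (condExpReal m μ p) :=
  (measurable_condLExp m μ _).ennreal_toReal.sub (measurable_condLExp m μ _).ennreal_toReal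

theorem measurable_condExpComplex (f : X → ℂ) : Measurable[m] (condExpComplex m μ f) :=
  (Complex.measurable_ofReal.comp (measurable_condExpReal _)).add
    ((Complex.measurable_ofReal.comp (measurable_condExpReal _)).mul_const _)

theorem condExpReal_eq_zero_on (hm : m ≤ m₀) [SigmaFinite (μ.trim hm)] {p : X → ℝ} {s : Set X}
    (hs : MeasurableSet[m] s) (h : ∀ᵐ x ∂μ, x ∈ s → p x = 0) :
    ∀ᵐ x ∂μ, x ∈ s → condExpReal m μ p x = 0 := by
  filter_upwards [condLExp_eq_zero_on (k := fun t => ENNReal.ofReal (p t)) hm hs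
      (by filter_upwards [h] with x hx hxs; simp [hx hxs]),
    condLExp_eq_zero_on (k := fun t => ENNReal.ofReal (-p t)) hm hs
      (by filter_upwards [h] with x hx hxs; simp [hx hxs])] with x h1 h2 hx
  simp [condExpReal, h1 hx, h2 hx]

theorem condExpComplex_eq_zero_on (hm : m ≤ m₀) [SigmaFinite (μ.trim hm)] {f : X → ℂ} {s : Set X}
    (hs : MeasurableSet[m] s) (h : ∀ᵐ x ∂μ, x ∈ s → f x = 0) :
    ∀ᵐ x ∂μ, x ∈ s → condExpComplex m μ f x = 0 := by
  filter_upwards [condExpReal_eq_zero_on (p := fun t => (f t).re) hm hs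
      (by filter_upwards [h] with x hx hxs; simp [hx hxs]),
    condExpReal_eq_zero_on (p := fun t => (f t).im) hm hs
      (by filter_upwards [h] with x hx hxs; simp [hx hxs])] with x h1 h2 hx
  simp [condExpComplex, h1 hx, h2 hx]

/-- On `s` the positive and negative parts of `p` have the same conditional expectation, hence the
same integral over `s`. Integrability is asked on `s` only, since conditionable functions need not
be integrable. -/
theorem setIntegral_eq_zero_of_condExpReal (hm : m ≤ m₀) [SigmaFinite (μ.trim hm)] {p : X → ℝ}
    {s : Set X} (hs : MeasurableSet[m] s) (hp : IntegrableOn p s μ)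
    (hfin : ∀ᵐ x ∂μ, condLExp m μ (fun t => ‖p t‖ₑ) x < ∞)
    (h : ∀ᵐ x ∂μ, x ∈ s → condExpReal m μ p x = 0) : ∫ x in s, p x ∂μ = 0 := by
  rw [integral_eq_lintegral_pos_part_sub_lintegral_neg_part hp, ← setLIntegral_condLExp hm _ (fun t => ENNReal.ofReal (p t)) hs,
    ← setLIntegral_condLExp hm _ (fun t => ENNReal.ofReal (-p t)) hs, sub_eq_zero]
  congr 1
  refine setLIntegral_congr_fun_ae (hm s hs) ?_
  have bd : ∀ r : ℝ, ENNReal.ofReal (-r) ≤ ‖r‖ₑ := fun r => by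
    simpa using Real.ofReal_le_enorm (-r)
  -- Finiteness is what turns equality after `toReal` into equality in `[0, ∞]`.
  filter_upwards [condLExp_lt_top_of_le (fun x => Real.ofReal_le_enorm (p x)) hfin,
    condLExp_lt_top_of_le (fun x => bd (p x)) hfin, h] with x h1 h2 h3 hx
  have h4 := h3 hx
  rw [condExpReal, sub_eq_zero] at h4
  exact (ENNReal.toReal_eq_toReal_iff' h1.ne h2.ne).1 h4

theorem setIntegral_eq_zero_of_condExpComplex (hm : m ≤ m₀) [SigmaFinite (μ.trim hm)]
    {f : X → ℂ} {s : Set X} (hs : MeasurableSet[m] s) (hf : IntegrableOn f s μ)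
    (hfc : Conditionable m μ f)
    (h : ∀ᵐ x ∂μ, x ∈ s → condExpComplex m μ f x = 0) : ∫ x in s, f x ∂μ = 0 := by
  have h1 := setIntegral_eq_zero_of_condExpReal hm hs hf.re hfc.re (by
    filter_upwards [h] with x hx hxs
    simpa [condExpComplex] using congrArg Complex.re (hx hxs))
  have h2 := setIntegral_eq_zero_of_condExpReal hm hs hf.im hfc.im (by
    filter_upwards [h] with x hx hxs
    simpa [condExpComplex] using congrArg Complex.im (hx hxs))
  have h3 := integral_re_add_im (𝕜 := ℂ) hf
  rw [← h3, h1, h2]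
  simp

/-- The pull-out property for the product of a nonnegative function with a function measurable
for the smaller `σ`-algebra. -/
theorem condExpReal_mul_toReal (hm : m ≤ m₀) [SigmaFinite (μ.trim hm)] {k : X → ℝ≥0∞}
    (hk : AEMeasurable k μ) (hk' : ∀ x, k x ≠ ∞) {p : X → ℝ} (hp : Measurable[m] p) :
    condExpReal m μ (fun t => p t * (k t).toReal) =ᵐ[μ]
      fun x => p x * (condLExp m μ k x).toReal := by
  have g : ∀ q : X → ℝ, (fun t => ENNReal.ofReal (q t * (k t).toReal)) =
      fun t => ENNReal.ofReal (q t) * k t := fun q => by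
    ext t; rw [ENNReal.ofReal_mul' ENNReal.toReal_nonneg, ENNReal.ofReal_toReal (hk' t)]
  filter_upwards [condLExp_mul_left hm hp.ennreal_ofReal hk,
    condLExp_mul_left hm hp.neg.ennreal_ofReal hk] with x h1 h2
  simp only [condExpReal, ← neg_mul, g]
  rw [h1]
  have h2' : condLExp m μ (fun t => ENNReal.ofReal (-p t) * k t) x = _ := h2
  -- No finiteness of `E(k)` is needed: where it is `∞`, `toReal` makes both sides `0`.
  rw [h2', ENNReal.toReal_mul, ENNReal.toReal_mul, ← sub_mul, Pi.neg_apply,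
    ENNReal.toReal_ofReal', ENNReal.toReal_ofReal', max_zero_sub_eq_self]

/-- Since `u · ū h = |u|² h`, the pull-out property applies to the real and imaginary parts of `h`.
This computes `T` on the vectors `ū h`. -/
theorem condExpComplex_mul_conj_mul (hm : m ≤ m₀) [SigmaFinite (μ.trim hm)] {u h : X → ℂ}
    (hu : AEMeasurable u μ) (hh : Measurable[m] h) :
    condExpComplex m μ (fun t => u t * (starRingEnd ℂ (u t) * h t)) =ᵐ[μ]
      fun x => (condSq m μ u x).toReal * h x := by
  have hk : AEMeasurable (fun t => ‖u t‖ₑ ^ 2) μ := hu.enorm.pow_const 2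
  have e : ∀ t, u t * (starRingEnd ℂ (u t) * h t) = ((‖u t‖ₑ ^ 2).toReal : ℂ) * h t := fun t => by
    rw [← mul_assoc, Complex.mul_conj, Complex.normSq_eq_norm_sq]; simp
  have hk' : ∀ t, ‖u t‖ₑ ^ 2 ≠ ∞ := fun t => by finiteness
  filter_upwards [condExpReal_mul_toReal hm hk hk' (Complex.measurable_re.comp hh),
    condExpReal_mul_toReal hm hk hk' (Complex.measurable_im.comp hh)] with x h1 h2
  simp only [Function.comp_apply] at h1 h2
  simp only [condExpComplex, e, Complex.re_ofReal_mul, Complex.im_ofReal_mul]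
  simp only [mul_comm _ (Complex.re _), mul_comm _ (Complex.im _), h1, h2, condSq]
  apply Complex.ext <;> simp [mul_comm]

theorem conditionable_mul_conj_mul (hm : m ≤ m₀) [SigmaFinite (μ.trim hm)] {u h : X → ℂ}
    (hu : AEMeasurable u μ) (hh : Measurable[m] h) (ha : ∀ᵐ x ∂μ, condSq m μ u x < ∞) :
    Conditionable m μ (fun t => u t * (starRingEnd ℂ (u t) * h t)) := by
  have e : (fun t => ‖u t * (starRingEnd ℂ (u t) * h t)‖ₑ) = fun t => ‖h t‖ₑ * ‖u t‖ₑ ^ 2 := by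
    ext t
    rw [enorm_mul, enorm_mul, RCLike.enorm_conj]
    ring
  rw [Conditionable, e]
  filter_upwards [condLExp_mul_left (h := fun t => ‖h t‖ₑ) hm (measurable_enorm.comp hh) (hu.enorm.pow_const 2), ha] with x h1 h2
  rw [h1]
  exact ENNReal.mul_lt_top enorm_lt_top h2

theorem lintegral_enorm_mul_sq (hm : m ≤ m₀) [SigmaFinite (μ.trim hm)] {w h : X → ℂ}
    (hw : AEMeasurable w μ) (hh : Measurable[m] h) :
    ∫⁻ x, ‖w x * h x‖ₑ ^ 2 ∂μ = ∫⁻ x, ‖h x‖ₑ ^ 2 * condSq m μ w x ∂μ := by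
  have h1 := lintegral_mul_condLExp (μ := μ) hm ((measurable_enorm.comp hh).pow_const 2) (hw.enorm.pow_const 2)
  simp only [Function.comp_apply] at h1
  rw [condSq, h1]
  exact lintegral_congr fun x => by rw [enorm_mul, mul_pow, mul_comm]

/-- Under the condition `(⋆)`, measurable functions are conditionally square integrable. -/
theorem condSq_lt_top (hm : m ≤ m₀) [SigmaFinite μ] [SigmaFinite (μ.trim hm)]
    (hstar : StarCondition μ) {u : X → ℂ} (hu : Measurable[m₀] u) :
    ∀ᵐ x ∂μ, condSq m μ u x < ∞ := by
  refine condLExp_lt_top_of_setLIntegral hm fun k => ?_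
  set A := spanningSets (μ.trim hm) k
  have hA : MeasurableSet[m] A := measurableSet_spanningSets _ k
  have hA' : μ A < ∞ := by
    rw [← trim_measurableSet_eq hm hA]; exact measure_spanningSets_lt_top _ k
  -- The sets `{|u| ≤ n}`, cut down to finite measure, increase to the whole space. By `(⋆)` one of
  -- them contains `A` up to a null set, so `u` is essentially bounded on `A`.
  obtain ⟨n, hn⟩ := hstar (fun n => {x | ‖u x‖ ≤ n} ∩ spanningSets μ n)
    (fun i j hij => inter_subset_inter
      (fun x (hx : ‖u x‖ ≤ i) => hx.trans (by exact_mod_cast hij)) (monotone_spanningSets μ hij))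
    (fun n => (measurableSet_le hu.norm measurable_const).inter (measurableSet_spanningSets μ n))
    (fun n => (measure_mono inter_subset_right).trans_lt (measure_spanningSets_lt_top μ n))
    (by
      refine (eq_univ_of_forall fun x => ?_).eventuallyEq
      obtain ⟨i, hi⟩ := mem_iUnion.1 ((iUnion_spanningSets μ).symm ▸ mem_univ x)
      obtain ⟨j, hj⟩ := exists_nat_ge ‖u x‖
      refine mem_iUnion.2 ⟨max i j, ?_, monotone_spanningSets μ (le_max_left i j) hi⟩
      exact hj.trans (by exact_mod_cast le_max_right i j))
    A (hm _ hA) hA'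
  have hb : ∀ᵐ x ∂μ, x ∈ A → ‖u x‖ₑ ^ 2 ≤ (n : ℝ≥0∞) ^ 2 := by
    filter_upwards [hn] with x hx hxA
    have h1 : ‖u x‖ ≤ n := (hx hxA).1
    gcongr
    rw [← ofReal_norm]
    exact (ENNReal.ofReal_le_ofReal h1).trans (by simp)
  refine ne_top_of_le_ne_top ?_ (setLIntegral_mono_ae' (hm _ hA) hb)
  rw [setLIntegral_const]
  exact ENNReal.mul_ne_top (by finiteness) hA'.ne

end CondExp

end WCT

namespace WCT

/-! ### `L²` norms and the action of the operator -/

section L2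

variable {X : Type*} {m m₀ : MeasurableSpace X} {μ : Measure[m₀] X}

theorem eLpNorm_two_sq (f : X → ℂ) : eLpNorm f 2 μ ^ 2 = ∫⁻ x, ‖f x‖ₑ ^ 2 ∂μ := by
  simpa using eLpNorm_nnreal_pow_eq_lintegral (μ := μ) (f := f) (p := 2) two_ne_zero

theorem memLp_two_of_lintegral {f : X → ℂ} (hf : AEMeasurable f μ)
    (h : ∫⁻ x, ‖f x‖ₑ ^ 2 ∂μ ≠ ∞) : MemLp f 2 μ := by
  refine ⟨hf.aestronglyMeasurable, lt_top_iff_ne_top.2 fun h' => h ?_⟩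
  rw [← eLpNorm_two_sq, h']
  simp

/-- Squared and in `[0, ∞]`, norm bounds become comparisons of lower integrals. -/
theorem norm_le_mul_norm_iff {E F : Type*} [NormedAddCommGroup E] [NormedAddCommGroup F]
    (C : ℝ≥0) (f : E) (g : F) :
    ‖f‖ ≤ C * ‖g‖ ↔ ‖f‖ₑ ^ 2 ≤ (C : ℝ≥0∞) ^ 2 * ‖g‖ₑ ^ 2 := by
  rw [← mul_pow, ENNReal.pow_le_pow_left_iff two_ne_zero, enorm_eq_nnnorm, enorm_eq_nnnorm]
  norm_cast

theorem enorm_toReal {a : ℝ≥0∞} (ha : a ≠ ∞) : ‖(a.toReal : ℂ)‖ₑ = a := by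
  rw [← ofReal_norm, Complex.norm_real, Real.norm_of_nonneg ENNReal.toReal_nonneg,
    ENNReal.ofReal_toReal ha]

theorem measurableSet_suppSet (u w : X → ℂ) : MeasurableSet[m] (suppSet m μ u w) :=
  (measurable_condLExp m μ _ (measurableSet_singleton 0).compl).inter
    (measurable_condLExp m μ _ (measurableSet_singleton 0).compl)

variable {u w : X →ₘ[μ] ℂ}

theorem coeFn_wctOp (f : (wctOp m μ u w).domain) :
    wctOp m μ u w f =ᵐ[μ]
      fun x => w x * condExpComplex m μ (fun t => u t * (f : Lp ℂ 2 μ) t) x :=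
  MemLp.coeFn_toLp f.2.2

theorem enorm_wctOp_sq (hm : m ≤ m₀) [SigmaFinite (μ.trim hm)] (f : (wctOp m μ u w).domain) :
    ‖wctOp m μ u w f‖ₑ ^ 2 =
      ∫⁻ x, ‖condExpComplex m μ (fun t => u t * (f : Lp ℂ 2 μ) t) x‖ₑ ^ 2 * condSq m μ w x ∂μ := by
  rw [Lp.enorm_def, eLpNorm_two_sq,
    ← lintegral_enorm_mul_sq hm w.aemeasurable (measurable_condExpComplex _)]
  refine lintegral_congr_ae ?_
  filter_upwards [coeFn_wctOp f] with x hx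
  rw [hx]

/-! ### The vectors `ū h` with `h` measurable for `𝒜` -/

section Conj

variable {h : X → ℂ} {g : Lp ℂ 2 μ}

theorem mul_coeFn_ae_eq_mul_conj_mul (hg : g =ᵐ[μ] fun x => starRingEnd ℂ (u x) * h x) :
    (fun x => u x * (starRingEnd ℂ (u x) * h x)) =ᵐ[μ] fun x => u x * g x := by
  filter_upwards [hg] with x hx
  rw [hx]

theorem condExpComplex_mul_coeFn (hm : m ≤ m₀) [SigmaFinite (μ.trim hm)] (hh : Measurable[m] h)
    (hg : g =ᵐ[μ] fun x => starRingEnd ℂ (u x) * h x) :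
    condExpComplex m μ (fun t => u t * g t) =ᵐ[μ] fun x => (condSq m μ u x).toReal * h x :=
  (condExpComplex_congr (mul_coeFn_ae_eq_mul_conj_mul hg).symm).trans
    (condExpComplex_mul_conj_mul hm u.aemeasurable hh)

theorem mem_wctDomain_of_memLp (hm : m ≤ m₀) [SigmaFinite (μ.trim hm)] (hh : Measurable[m] h)
    (ha : ∀ᵐ x ∂μ, condSq m μ u x < ∞) (hg : g =ᵐ[μ] fun x => starRingEnd ℂ (u x) * h x)
    (hT : MemLp (fun x => w x * ((condSq m μ u x).toReal * h x)) 2 μ) :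
    g ∈ (wctOp m μ u w).domain := by
  refine ⟨(conditionable_mul_conj_mul hm u.aemeasurable hh ha).congr
    (mul_coeFn_ae_eq_mul_conj_mul hg), (memLp_congr_ae ?_).1 hT⟩
  filter_upwards [condExpComplex_mul_coeFn hm hh hg] with x hx
  rw [hx]

theorem lintegral_enorm_conj_mul_sq (hm : m ≤ m₀) [SigmaFinite (μ.trim hm)]
    (hh : Measurable[m] h) :
    ∫⁻ x, ‖starRingEnd ℂ (u x) * h x‖ₑ ^ 2 ∂μ = ∫⁻ x, ‖h x‖ₑ ^ 2 * condSq m μ u x ∂μ := by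
  rw [← lintegral_enorm_mul_sq hm u.aemeasurable hh]
  exact lintegral_congr fun x => by simp only [enorm_mul, RCLike.enorm_conj]

end Conj

/-! ### Lower bounds on the orthogonal complement of the null space -/

theorem ae_condExpComplex_eq_zero (hm : m ≤ m₀) [SigmaFinite (μ.trim hm)] (f : X → ℂ) :
    ∀ᵐ x ∂μ, condSq m μ u x = 0 → condExpComplex m μ (fun t => u t * f t) x = 0 := by
  have hs : MeasurableSet[m] {x | condSq m μ u x = 0} :=
    measurable_condLExp m μ _ (measurableSet_singleton 0)
  refine condExpComplex_eq_zero_on (f := fun t => u t * f t) hm hs ?_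
  filter_upwards [ae_eq_zero_of_condLExp_eq_zero (m := m) hm
    (u.aemeasurable.enorm.pow_const 2)] with x hx hxs
  have : u x = 0 := by simpa using hx hxs
  simp [this]

/-- If `1 ≤ C² E(|u|²) E(|w|²)` on `S`, then `M_w E M_u` is bounded below by `1 / C` on the
orthogonal complement of its null space. -/
theorem norm_le_of_mem_orthogonal_nullSub (hm : m ≤ m₀) [SigmaFinite (μ.trim hm)]
    (ha : ∀ᵐ x ∂μ, condSq m μ u x < ∞) {C : ℝ≥0}
    (hC : ∀ᵐ x ∂μ, x ∈ suppSet m μ u w → 1 ≤ (C : ℝ≥0∞) ^ 2 * (condSq m μ u x * condSq m μ w x))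
    (f : (wctOp m μ u w).domain) (hf : (f : Lp ℂ 2 μ) ∈ (wctOp m μ u w).nullSubᗮ) :
    ‖(f : Lp ℂ 2 μ)‖ ≤ C * ‖wctOp m μ u w f‖ := by
  set E := condExpComplex m μ (fun t => u t * (f : Lp ℂ 2 μ) t) with hE
  set S := suppSet m μ u w with hS
  have hEm : Measurable[m] E := measurable_condExpComplex _
  have ham : Measurable[m] (condSq m μ u) := measurable_condLExp m μ _
  -- Chosen so that `a h = E(uf)` on `S`, which makes `T(ū h) = T f`.
  set h : X → ℂ := S.indicator fun x => E x / ((condSq m μ u x).toReal : ℂ) with hh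
  have hhm : Measurable[m] h :=
    (hEm.div (Complex.measurable_ofReal.comp ham.ennreal_toReal)).indicator
      (measurableSet_suppSet u w)
  -- On `S`, `|h|² a ≤ |h|² a · C² a b = C² |a h|² b`, and `a h = E(uf)`. This bound also shows that
  -- `ū h` is in `L²`.
  have hle : ∫⁻ x, ‖starRingEnd ℂ (u x) * h x‖ₑ ^ 2 ∂μ ≤
      (C : ℝ≥0∞) ^ 2 * ‖wctOp m μ u w f‖ₑ ^ 2 := by
    rw [lintegral_enorm_conj_mul_sq hm hhm, enorm_wctOp_sq hm,
      ← lintegral_const_mul' _ _ (by finiteness)]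
    refine lintegral_mono_ae ?_
    filter_upwards [hC, ha] with x h1 h2
    by_cases hx : x ∈ S
    · have h3 : E x = h x * ((condSq m μ u x).toReal : ℂ) := by
        simp only [hh, indicator_of_mem hx]
        rw [div_mul_cancel₀]
        simpa [ENNReal.toReal_eq_zero_iff] using ⟨hx.1, h2.ne⟩
      rw [← hE, h3, enorm_mul, enorm_toReal h2.ne]
      calc ‖h x‖ₑ ^ 2 * condSq m μ u x = ‖h x‖ₑ ^ 2 * condSq m μ u x * 1 := (mul_one _).symm
        _ ≤ ‖h x‖ₑ ^ 2 * condSq m μ u x *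
              ((C : ℝ≥0∞) ^ 2 * (condSq m μ u x * condSq m μ w x)) := by
            gcongr; exact h1 hx
        _ = _ := by ring
    · simp [hh, hx]
  have hgL : MemLp (fun x => starRingEnd ℂ (u x) * h x) 2 μ := by
    refine memLp_two_of_lintegral ?_ (ne_top_of_le_ne_top (by finiteness) hle)
    exact (Complex.continuous_conj.measurable.comp_aemeasurable u.aemeasurable).mul
      (hhm.mono hm le_rfl).aemeasurable
  have hgc : hgL.toLp _ =ᵐ[μ] fun x => starRingEnd ℂ (u x) * h x := hgL.coeFn_toLp
  set g : Lp ℂ 2 μ := hgL.toLp _ with hg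
  -- Off `S` both sides vanish: `E(uf) = 0` where `a = 0`, and `w = 0` where `b = 0`.
  have hTeq : (fun x => w x * E x) =ᵐ[μ] fun x => w x * ((condSq m μ u x).toReal * h x) := by
    filter_upwards [ha, ae_condExpComplex_eq_zero (u := u) hm (f : Lp ℂ 2 μ),
      ae_eq_zero_of_condLExp_eq_zero (m := m) hm (w.aemeasurable.enorm.pow_const 2)]
      with x h1 h2 h3
    by_cases hx : x ∈ S
    · have hx0 : ((condSq m μ u x).toReal : ℂ) ≠ 0 := by
        simpa [ENNReal.toReal_eq_zero_iff] using ⟨hx.1, h1.ne⟩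
      simp only [hh, indicator_of_mem hx]
      rw [mul_div_cancel₀ _ hx0]
    · simp only [hh, indicator_of_notMem hx, mul_zero]
      rcases not_and_or.1 hx with hx | hx
      · rw [hE, h2 (not_not.1 hx), mul_zero]
      · have : w x = 0 := by simpa using h3 (not_not.1 hx)
        rw [this, zero_mul]
  have hgD : g ∈ (wctOp m μ u w).domain :=
    mem_wctDomain_of_memLp hm hhm ha hgc ((memLp_congr_ae hTeq).1 f.2.2)
  have hTg : wctOp m μ u w f = wctOp m μ u w ⟨g, hgD⟩ := by
    apply Lp.ext
    filter_upwards [hTeq, coeFn_wctOp f, coeFn_wctOp ⟨g, hgD⟩,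
      condExpComplex_mul_coeFn hm hhm hgc] with x h1 h2 h3 h4
    rw [h2, h3, h4, ← h1]
  have hd : (f : Lp ℂ 2 μ) - g ∈ (wctOp m μ u w).nullSub := by
    rw [LinearPMap.mem_nullSub, LinearPMap.mem_graph_iff]
    exact ⟨f - ⟨g, hgD⟩, rfl, by rw [LinearPMap.map_sub, hTg, sub_self]⟩
  have hi := (Submodule.mem_orthogonal _ _).1 hf _ hd
  -- Orthogonality of `f` and `f - g` gives `‖f‖² = ⟪g, f⟫`; then Cauchy-Schwarz.
  have hfg : ‖(f : Lp ℂ 2 μ)‖ ≤ ‖g‖ := by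
    rw [inner_sub_left, sub_eq_zero] at hi
    have h1 : ‖(f : Lp ℂ 2 μ)‖ * ‖(f : Lp ℂ 2 μ)‖ ≤ ‖g‖ * ‖(f : Lp ℂ 2 μ)‖ := by
      have h2 := norm_inner_le_norm (𝕜 := ℂ) g (f : Lp ℂ 2 μ)
      rwa [← hi, inner_self_eq_norm_sq_to_K, norm_pow, RCLike.norm_ofReal, abs_norm, sq] at h2
    rcases (norm_nonneg (f : Lp ℂ 2 μ)).eq_or_lt with h0 | h0
    · rw [← h0]; exact norm_nonneg _
    · exact le_of_mul_le_mul_right h1 h0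
  refine hfg.trans ((norm_le_mul_norm_iff _ _ _).2 ?_)
  rwa [Lp.enorm_toLp, eLpNorm_two_sq]

/-- If `T g = 0`, then `∫ |E(ug)|² b = 0`, so `E(ug) = 0` on `B` because `b ≠ 0` there. Since `B ∈
𝒜`, the inner product `⟪f, g⟫ = ∫_B u g` vanishes. -/
theorem conj_mul_indicator_mem_orthogonal_nullSub (hm : m ≤ m₀) [SigmaFinite (μ.trim hm)]
    {B : Set X} (hB : MeasurableSet[m] B) (hBw : ∀ x ∈ B, condSq m μ w x ≠ 0) {f : Lp ℂ 2 μ}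
    (hf : f =ᵐ[μ] fun x => starRingEnd ℂ (u x) * B.indicator 1 x) :
    f ∈ (wctOp m μ u w).nullSubᗮ := by
  rw [Submodule.mem_orthogonal]
  intro g hg
  rw [LinearPMap.mem_nullSub, LinearPMap.mem_graph_iff] at hg
  obtain ⟨g, rfl, hg⟩ := hg
  rw [inner_eq_zero_symm, L2.inner_def]
  have e : (fun x => inner ℂ (f x) ((g : Lp ℂ 2 μ) x)) =ᵐ[μ]
      B.indicator fun x => u x * (g : Lp ℂ 2 μ) x := by
    filter_upwards [hf] with x hx
    rw [hx]
    by_cases hxB : x ∈ B <;> simp [hxB, mul_comm]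
  rw [integral_congr_ae e, integral_indicator (hm B hB)]
  refine setIntegral_eq_zero_of_condExpComplex hm hB ?_ g.2.1 ?_
  -- On `B`, `u g` is integrable as the pointwise inner product of two `L²` functions.
  · rw [← integrable_indicator_iff (hm B hB)]
    exact (L2.integrable_inner (𝕜 := ℂ) f (g : Lp ℂ 2 μ)).congr e
  · have h0 := enorm_wctOp_sq hm g
    simp only at hg
    have hE : Measurable[m₀] (condExpComplex m μ fun t => u t * (g : Lp ℂ 2 μ) t) :=
      (measurable_condExpComplex _).mono hm le_rfl
    have hmeas : Measurable[m₀] fun x =>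
        ‖condExpComplex m μ (fun t => u t * (g : Lp ℂ 2 μ) t) x‖ₑ ^ 2 * condSq m μ w x :=
      (hE.enorm.pow_const 2).mul (measurable_condLExp' m μ _)
    rw [hg, enorm_zero, zero_pow two_ne_zero, eq_comm, lintegral_eq_zero_iff hmeas] at h0
    filter_upwards [h0] with x hx hxB
    simpa [hBw x hxB] using hx

/-- Testing a lower bound for `M_w E M_u` against the functions `conj u · χ_B`. -/
theorem setLIntegral_condSq_le (hm : m ≤ m₀) [SigmaFinite (μ.trim hm)]
    (ha : ∀ᵐ x ∂μ, condSq m μ u x < ∞) {C : ℝ≥0}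
    (hC : ∀ f : (wctOp m μ u w).domain, (f : Lp ℂ 2 μ) ∈ (wctOp m μ u w).nullSubᗮ →
      ‖(f : Lp ℂ 2 μ)‖ ≤ C * ‖wctOp m μ u w f‖)
    {B : Set X} (hB : MeasurableSet[m] B) (hμB : μ B < ∞) (hBw : ∀ x ∈ B, condSq m μ w x ≠ 0)
    {n : ℝ≥0} (hun : ∀ x ∈ B, condSq m μ u x ≤ n) (hwn : ∀ x ∈ B, condSq m μ w x ≤ n) :
    ∫⁻ x in B, condSq m μ u x ∂μ ≤
      ∫⁻ x in B, (C : ℝ≥0∞) ^ 2 * (condSq m μ u x ^ 2 * condSq m μ w x) ∂μ := by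
  have hhm : Measurable[m] (B.indicator (1 : X → ℂ)) := (@measurable_const _ _ _ m 1).indicator hB
  have ham : Measurable[m] (condSq m μ u) := measurable_condLExp m μ _
  have e1 : ∫⁻ x, ‖starRingEnd ℂ (u x) * B.indicator 1 x‖ₑ ^ 2 ∂μ =
      ∫⁻ x in B, condSq m μ u x ∂μ := by
    rw [lintegral_enorm_conj_mul_sq hm hhm, ← lintegral_indicator (hm B hB)]
    exact lintegral_congr fun x => by by_cases hx : x ∈ B <;> simp [hx]
  have hkm : Measurable[m] fun x => ((condSq m μ u x).toReal : ℂ) * B.indicator 1 x :=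
    (Complex.measurable_ofReal.comp ham.ennreal_toReal).mul hhm
  have e2 : ∫⁻ x, ‖((condSq m μ u x).toReal : ℂ) * B.indicator 1 x‖ₑ ^ 2 * condSq m μ w x ∂μ =
      ∫⁻ x in B, condSq m μ u x ^ 2 * condSq m μ w x ∂μ := by
    rw [← lintegral_indicator (hm B hB)]
    refine lintegral_congr_ae ?_
    filter_upwards [ha] with x hx
    by_cases hxB : x ∈ B
    · simp only [indicator_of_mem hxB, Pi.one_apply, mul_one]
      rw [enorm_toReal hx.ne]
    · simp [hxB]
  -- Boundedness of `a` and `b` on `B` and `μ B < ∞` put `ū χ_B` in `L²` and in the domain of `T`.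
  have bound : ∀ (k : X → ℝ≥0∞) (c : ℝ≥0), (∀ x ∈ B, k x ≤ c) → ∫⁻ x in B, k x ∂μ ≠ ∞ := by
    intro k c hk
    refine ne_top_of_le_ne_top ?_ (setLIntegral_mono' (hm B hB) hk)
    rw [setLIntegral_const]
    exact ENNReal.mul_ne_top ENNReal.coe_ne_top hμB.ne
  have hfL : MemLp (fun x => starRingEnd ℂ (u x) * B.indicator 1 x) 2 μ := by
    refine memLp_two_of_lintegral ?_ (e1 ▸ bound _ n hun)
    exact (Complex.continuous_conj.measurable.comp_aemeasurable u.aemeasurable).mul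
      (hhm.mono hm le_rfl).aemeasurable
  have hfc : hfL.toLp _ =ᵐ[μ] fun x => starRingEnd ℂ (u x) * B.indicator 1 x := hfL.coeFn_toLp
  have hTL : MemLp (fun x => w x * ((condSq m μ u x).toReal * B.indicator 1 x)) 2 μ := by
    refine memLp_two_of_lintegral (w.aemeasurable.mul (hkm.mono hm le_rfl).aemeasurable) ?_
    rw [lintegral_enorm_mul_sq hm w.aemeasurable hkm, e2]
    refine bound _ (n ^ 2 * n) fun x hx => ?_
    push_cast
    exact mul_le_mul' (pow_le_pow_left' (hun x hx) 2) (hwn x hx)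
  have hfD := mem_wctDomain_of_memLp (w := w) hm hhm ha hfc hTL
  have h1 := (norm_le_mul_norm_iff _ _ _).1 (hC ⟨hfL.toLp _, hfD⟩
    (conj_mul_indicator_mem_orthogonal_nullSub hm hB hBw hfc))
  rw [Lp.enorm_toLp, eLpNorm_two_sq, e1, enorm_wctOp_sq hm] at h1
  rw [lintegral_const_mul' _ _ (by finiteness), ← e2]
  refine h1.trans_eq ?_
  congr 1
  refine lintegral_congr_ae ?_
  filter_upwards [condExpComplex_mul_coeFn hm hhm hfc] with x hx
  rw [hx]

/-- `S` is exhausted up to a null set by the sets `B n` on which `a, b ≤ n`. The integral inequality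
on all `𝒜`-subsets of finite measure of `B n` localizes to `a ≤ C² a² b` a.e. there. -/
theorem one_le_of_lower_bound (hm : m ≤ m₀) [SigmaFinite (μ.trim hm)]
    (ha : ∀ᵐ x ∂μ, condSq m μ u x < ∞) (hb : ∀ᵐ x ∂μ, condSq m μ w x < ∞) {C : ℝ≥0}
    (hC : ∀ f : (wctOp m μ u w).domain, (f : Lp ℂ 2 μ) ∈ (wctOp m μ u w).nullSubᗮ →
      ‖(f : Lp ℂ 2 μ)‖ ≤ C * ‖wctOp m μ u w f‖) :
    ∀ᵐ x ∂μ, x ∈ suppSet m μ u w →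
      1 ≤ (C : ℝ≥0∞) ^ 2 * (condSq m μ u x * condSq m μ w x) := by
  have ham : Measurable[m] (condSq m μ u) := measurable_condLExp m μ _
  have hbm : Measurable[m] (condSq m μ w) := measurable_condLExp m μ _
  let B : ℕ → Set X := fun n => suppSet m μ u w ∩ ({x | condSq m μ u x ≤ n} ∩
    {x | condSq m μ w x ≤ n})
  have hB : ∀ n, MeasurableSet[m] (B n) := fun n => (measurableSet_suppSet u w).inter
    ((measurableSet_le ham measurable_const).inter (measurableSet_le hbm measurable_const))
  set F : X → ℝ≥0∞ := fun x => (C : ℝ≥0∞) ^ 2 * (condSq m μ u x ^ 2 * condSq m μ w x) with hF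
  have hFm : Measurable[m] F := ((ham.pow_const 2).mul hbm).const_mul _
  have key : ∀ n, (B n).indicator (condSq m μ u) ≤ᵐ[μ] (B n).indicator F := by
    intro n
    -- Only sets of `𝒜` can be tested, so the comparison takes place for the `σ`-finite measure
    -- `μ|𝒜`; both functions are `𝒜`-measurable.
    refine ae_le_of_ae_le_trim (hm := hm) ?_
    refine ae_le_of_forall_setLIntegral_le_of_sigmaFinite (ham.indicator (hB n)) ?_
    intro s hs hμs
    rw [trim_measurableSet_eq hm hs] at hμs
    rw [setLIntegral_trim hm (ham.indicator (hB n)) hs,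
      setLIntegral_trim hm (hFm.indicator (hB n)) hs,
      setLIntegral_indicator (hm _ (hB n)), setLIntegral_indicator (hm _ (hB n))]
    exact setLIntegral_condSq_le (n := n) hm ha hC ((hB n).inter hs)
      ((measure_mono inter_subset_right).trans_lt hμs) (fun x hx => hx.1.1.2)
      (fun x hx => by simpa using hx.1.2.1) (fun x hx => by simpa using hx.1.2.2)
  filter_upwards [ae_all_iff.2 key, ha, hb] with x h1 h2 h3 hx
  obtain ⟨i, hi⟩ := ENNReal.exists_nat_gt h2.ne
  obtain ⟨j, hj⟩ := ENNReal.exists_nat_gt h3.ne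
  have hxB : x ∈ B (max i j) :=
    ⟨hx, hi.le.trans (by exact_mod_cast le_max_left i j),
      hj.le.trans (by exact_mod_cast le_max_right i j)⟩
  have h4 := h1 (max i j)
  rw [indicator_of_mem hxB, indicator_of_mem hxB] at h4
  have hx0 : condSq m μ u x ≠ 0 := hx.1
  -- One factor `a` is cancelled, which is allowed since `0 < a < ∞` at `x`.
  refine (ENNReal.mul_le_mul_iff_right hx0 h2.ne).1 ?_
  rw [mul_one]
  refine h4.trans_eq ?_
  rw [hF]; ring

/-- The Moore-Penrose inverse of `M_w E M_u` is bounded by `C` iff `1 ≤ C² E(|u|²) E(|w|²)`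
on `S`. -/
theorem moorePenrose_wctOp_le_iff (hm : m ≤ m₀) [SigmaFinite (μ.trim hm)]
    (ha : ∀ᵐ x ∂μ, condSq m μ u x < ∞) (hb : ∀ᵐ x ∂μ, condSq m μ w x < ∞) (C : ℝ≥0) :
    (∀ y : (wctOp m μ u w).moorePenrose.domain,
        ‖(wctOp m μ u w).moorePenrose y‖ ≤ C * ‖(y : Lp ℂ 2 μ)‖) ↔
      ∀ᵐ x ∂μ, x ∈ suppSet m μ u w →
        1 ≤ (C : ℝ≥0∞) ^ 2 * (condSq m μ u x * condSq m μ w x) :=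
  (LinearPMap.moorePenrose_le_iff _ C.2).trans
    ⟨one_le_of_lower_bound hm ha hb, norm_le_of_mem_orthogonal_nullSub hm ha⟩

/-- Pointwise on `S`, `1 / √(ab) ≤ C` squares to `1 ≤ C² a b`, as `0 < ab < ∞`. The right-hand side
is the condition of `moorePenrose_wctOp_le_iff`. -/
theorem eLpNorm_indicator_one_div_le_iff
    (ha : ∀ᵐ x ∂μ, condSq m μ u x < ∞) (hb : ∀ᵐ x ∂μ, condSq m μ w x < ∞) (C : ℝ≥0) :
    eLpNorm ((suppSet m μ u w).indicator fun x =>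
      1 / (condSq m μ u x ^ (1 / 2 : ℝ) * condSq m μ w x ^ (1 / 2 : ℝ))) ∞ μ ≤ C ↔
      ∀ᵐ x ∂μ, x ∈ suppSet m μ u w →
        1 ≤ (C : ℝ≥0∞) ^ 2 * (condSq m μ u x * condSq m μ w x) := by
  have h1 : ∀ f : X → ℝ≥0∞, eLpNorm f ∞ μ ≤ C ↔ ∀ᵐ x ∂μ, f x ≤ C := fun f => by
    rw [eLpNorm_exponent_top, eLpNormEssSup]
    simp only [enorm_eq_self]
    exact ⟨fun h => (ENNReal.ae_le_essSup f).mono fun x hx => hx.trans h,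
      fun h => essSup_le_of_ae_le _ h⟩
  rw [h1]
  refine eventually_congr ?_
  filter_upwards [ha, hb] with x h2 h3
  by_cases hx : x ∈ suppSet m μ u w
  · have hu0 : condSq m μ u x ≠ 0 := hx.1
    have hw0 : condSq m μ w x ≠ 0 := hx.2
    simp only [indicator_of_mem hx, hx, forall_true_left]
    set p := condSq m μ u x * condSq m μ w x with hp
    rw [← ENNReal.mul_rpow_of_nonneg _ _ (by norm_num), ← hp]
    have hp0 : p ≠ 0 := mul_ne_zero hu0 hw0
    have hpt : p ≠ ∞ := ENNReal.mul_ne_top h2.ne h3.ne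
    have hq0 : p ^ (1 / 2 : ℝ) ≠ 0 := by simp [hp0, hpt]
    have hqt : p ^ (1 / 2 : ℝ) ≠ ∞ := by finiteness
    have hq2 : (p ^ (1 / 2 : ℝ)) ^ 2 = p := by
      rw [← ENNReal.rpow_natCast, ← ENNReal.rpow_mul]; norm_num
    rw [ENNReal.div_le_iff hq0 hqt]
    conv_rhs => rw [← hq2, ← mul_pow, ← one_pow 2, ENNReal.pow_le_pow_left_iff two_ne_zero]
  · simp [hx]

end L2

end WCT

/-! ### The boundedness criterion and the norm formula -/

theorem corollary2p11 {X : Type*} (m : MeasurableSpace X) {m₀ : MeasurableSpace X} (hm : m ≤ m₀)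
    (μ : Measure[m₀] X) [SigmaFinite μ] [SigmaFinite (μ.trim hm)]
    (hstar : WCT.StarCondition μ)
    (u w : X →ₘ[μ] ℂ) (hu : WCT.Conditionable m μ u) (hw : WCT.Conditionable m μ w)
    (hdense : Dense ((WCT.wctOp m μ u w).domain : Set (Lp ℂ 2 μ))) :
    ((WCT.wctOp m μ u w).moorePenrose.IsBoundedOp ↔
      ∃ r : ℝ≥0, 0 < r ∧ ∀ᵐ x ∂μ, x ∈ WCT.suppSet m μ u w →
        (r : ℝ≥0∞) ≤ WCT.condSq m μ u x * WCT.condSq m μ w x) ∧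
    ((WCT.wctOp m μ u w).moorePenrose.IsBoundedOp →
      (WCT.wctOp m μ u w).moorePenrose.opNorm =
        eLpNorm ((WCT.suppSet m μ u w).indicator fun x =>
          1 / (WCT.condSq m μ u x ^ (1 / 2 : ℝ) * WCT.condSq m μ w x ^ (1 / 2 : ℝ))) ∞ μ) := by
  have ha := WCT.condSq_lt_top hm hstar u.measurable
  have hb := WCT.condSq_lt_top hm hstar w.measurable
  have key := WCT.moorePenrose_wctOp_le_iff (u := u) (w := w) hm ha hb
  refine ⟨?_, fun _ => ?_⟩
  · rw [LinearPMap.isBoundedOp_iff_exists_nnreal]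
    simp only [key]
    constructor
    · rintro ⟨C, hC⟩
      -- The summand `1` covers `C = 0`, which occurs when `S` is null.
      have hD : (0 : ℝ≥0) < C ^ 2 + 1 := by positivity
      refine ⟨(C ^ 2 + 1)⁻¹, inv_pos.2 hD, ?_⟩
      filter_upwards [hC] with x hx hxS
      rw [ENNReal.coe_inv hD.ne', ENNReal.inv_le_iff_le_mul (by simp) (by simp)]
      refine (hx hxS).trans ?_
      gcongr
      push_cast
      exact le_self_add
    · rintro ⟨r, hr, h⟩
      -- `C = r^(-1/2)`, so that `C² a b ≥ r⁻¹ r = 1` on `S`.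
      refine ⟨NNReal.sqrt r⁻¹, ?_⟩
      filter_upwards [h] with x hx hxS
      rw [← ENNReal.coe_pow, NNReal.sq_sqrt]
      refine le_trans ?_ (mul_le_mul_right (hx hxS) _)
      rw [← ENNReal.coe_mul, inv_mul_cancel₀ hr.ne', ENNReal.coe_one]
  -- Two elements of `[0, ∞]` with the same upper bounds are equal; for finite bounds both
  -- conditions read `1 ≤ C² a b` on `S`.
  · refine eq_of_forall_ge_iff fun c => ?_
    induction c with
    | top => simp
    | coe C =>
      rw [LinearPMap.opNorm_le_iff, key, WCT.eLpNorm_indicator_one_div_le_iff ha hb]
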